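/- Let $\mathcal H=\ell^2(\mathbf Z^2;\mathbf C^4)$ with the inner product $(f,g)=\sum_{x}\sum_j f_j(x)\overline{g_j(x)}$, $j\in\{\leftarrow,\rightarrow,\downarrow,\uparrow\}$, and let $S$ be the shift $(Su)(x)=[u_\leftarrow(x+e_1),u_\rightarrow(x-e_1),u_\downarrow(x+e_2),u_\uparrow(x-e_2)]^{\mathsf T}$. Let $C(x)\in \mathrm U(4)$ for $x\in\mathbf Z^2$, and assume that there is a positive integer $M_0$ with $C(x)=I_4$ unless $|x_1|\le M_0$ and $|x_2|\le M_0$. Put $U=SC$, where $C$ is multiplication by $C(x)$, and $R(\kappa)=(U-e^{-i\kappa})^{-1}$. For $\theta\in\mathbf C$ let $T(\theta)$ be multiplication by $\mathrm{diag}[e^{i\theta x_1},e^{-i\theta x_1},e^{i\theta x_2},e^{-i\theta x_2}]$, let $U(\theta)=T(\theta)UT(\theta)^{-1}$, which is a bounded operator on $\mathcal H$, and let $R(\kappa,\theta)=(U(\theta)-e^{-i\kappa})^{-1}$. Let $\mathcal D$ be the set of all $f\in\mathcal H$ such that $e^{\tau\langle\cdot\rangle}f\in\mathcal H$ for every $\tau\ge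 0$, where $\langle x\rangle=(1+|x|^2)^{1/2}$. Functions of $\kappa$ are considered on the complex torus $\mathbf T_{\mathbf C}=\mathbf C/2\pi\mathbf Z$, i.e. they are $2\pi$-periodic. Then $\mathcal D$ is dense in $\mathcal H$, $R(\kappa)$ exists as a bounded operator for $\mathrm{Im}\,\kappa>0$, and the following holds. (1) For every $f\in\mathcal D$ and every $a<0$, the function $F_f(\kappa)=(R(\kappa)f,f)$, $\mathrm{Im}\,\kappa>0$, has a meromorphic extension to $\{\mathrm{Im}\,\kappa>a\}$. Every pole $\kappa$ of the extension in this region satisfies $\mathrm{Im}\,\kappa=0$ or $\mathrm{Im}\,\kappa<0$. (2) The poles are of finite rank, in the following sense. For every $\theta$ with $\mathrm{Im}\,\theta<0$, the operator $U(\theta)-e^{-i\kappa}$ is invertible for all $\kappa$ with $\mathrm{Im}\,\kappa>\mathrm{Im}\,\theta$ outside a discrete subset of this region, and $\kappa\mapsto R(\kappa,\theta)$ is meromorphic there with values in the bounded operators; all coefficients of the principal part at each pole have finite rank. Moreover, the extension of $F_f$ is given by $F_f(\kappa)=(R(\kappa,\theta)T(\theta)f,T(\overline\theta)f)$ for $\mathrm{Im}\,\kappa>\max\{a,\mathrm{Im}\,\theta\}$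 outside a discrete set. (3) The eigenvalues of $U(\theta)$ in $\{z\in\mathbf C\,;\,|z|>e^{\mathrm{Im}\,\theta}\}$ do not depend on $\theta$: if $\mathrm{Im}\,\theta_1\le0$, $\mathrm{Im}\,\theta_2\le 0$ and $|z|>\max\{e^{\mathrm{Im}\,\theta_1},e^{\mathrm{Im}\,\theta_2}\}$, then $z$ is an eigenvalue of $U(\theta_1)$ if and only if it is an eigenvalue of $U(\theta_2)$. -/

import Mathlib

open Filter Topology

noncomputable section

namespace QW

/-- The lattice `ℤ²`. -/
abbrev Site := ℤ × ℤ

/-- The fibre `ℂ⁴` with its Hermitian norm; the components `0, 1, 2, 3` stand for the directions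
`←, →, ↓, ↑`. -/
abbrev Spinor := EuclideanSpace ℂ (Fin 4)

/-- The Hilbert space `ℓ²(ℤ²; ℂ⁴)`. Mathlib's inner product is linear in the *second* variable. -/
abbrev Hil := lp (fun _ : Site => Spinor) 2

/-- Unit steps in the directions `←, →, ↓, ↑`. -/
def step : Fin 4 → Site := ![(-1, 0), (1, 0), (0, -1), (0, 1)]

/-- The shift `(Su)(x) = [u_←(x+e₁), u_→(x-e₁), u_↓(x+e₂), u_↑(x-e₂)]`, on all sequences. -/
def shift : (Site → Spinor) →ₗ[ℂ] (Site → Spinor) where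
  toFun u x := WithLp.toLp 2 fun j => u (x - step j) j
  map_add' _ _ := rfl
  map_smul' _ _ := rfl

/-- Multiplication by the unitary matrix `C(x)` at every site `x`, on all sequences. -/
def coinMul (C : Site → Matrix.unitaryGroup (Fin 4) ℂ) :
    (Site → Spinor) →ₗ[ℂ] (Site → Spinor) where
  toFun u x := WithLp.toLp 2 ((C x : Matrix (Fin 4) (Fin 4) ℂ).mulVec (u x))
  map_add' u v := by
    funext x; ext j; simp [Matrix.mulVec_add]
  map_smul' c u := by
    funext x; ext j; simp [Matrix.mulVec_smul]

/-- The diagonal entries of `T(θ)` at the site `x`. -/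
def phase (θ : ℂ) (x : Site) : Fin 4 → ℂ :=
  ![Complex.exp (Complex.I * θ * x.1), Complex.exp (-(Complex.I * θ * x.1)),
    Complex.exp (Complex.I * θ * x.2), Complex.exp (-(Complex.I * θ * x.2))]

/-- The complex translation
`(T(θ)u)(x) = diag[e^{iθx₁}, e^{-iθx₁}, e^{iθx₂}, e^{-iθx₂}] u(x)`, on all sequences.
Its inverse is `T(-θ)`. -/
def translate (θ : ℂ) : (Site → Spinor) →ₗ[ℂ] (Site → Spinor) where
  toFun u x := WithLp.toLp 2 fun j => phase θ x j * u x j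
  map_add' u v := by
    funext x; ext j; simp [mul_add]
  map_smul' c u := by
    funext x; ext j; simp [mul_left_comm]

/-- The coin is the identity outside a square `{|x₁| ≤ M₀, |x₂| ≤ M₀}`. -/
def TrivialOutsideSquare (C : Site → Matrix.unitaryGroup (Fin 4) ℂ) : Prop :=
  ∃ M₀ : ℕ, 0 < M₀ ∧ ∀ x : Site, ¬ (|x.1| ≤ (M₀ : ℤ) ∧ |x.2| ≤ (M₀ : ℤ)) → C x = 1

/-- The conjugated walk `T(θ) S C T(θ)⁻¹`, on all sequences. -/
def walkFun (C : Site → Matrix.unitaryGroup (Fin 4) ℂ) (θ : ℂ) :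
    (Site → Spinor) →ₗ[ℂ] (Site → Spinor) :=
  translate θ ∘ₗ shift ∘ₗ coinMul C ∘ₗ translate (-θ)

theorem phase_neg_mul (θ : ℂ) (x : Site) (j : Fin 4) : phase θ x j * phase (-θ) x j = 1 := by
  fin_cases j <;> simp [phase, ← Complex.exp_add]

theorem phase_step (θ : ℂ) (x : Site) (j : Fin 4) :
    phase θ x j = Complex.exp (-(Complex.I * θ)) * phase θ (x - step j) j := by
  fin_cases j <;> simp [phase, step, ← Complex.exp_add] <;> ring_nf

theorem walkFun_apply (C : Site → Matrix.unitaryGroup (Fin 4) ℂ) (θ : ℂ) (u : Site → Spinor)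
    (x : Site) (j : Fin 4) :
    walkFun C θ u x j = phase θ x j * ∑ k, (C (x - step j) : Matrix (Fin 4) (Fin 4) ℂ) j k *
      (phase (-θ) (x - step j) k * u (x - step j) k) := rfl

theorem walkFun_zero (C : Site → Matrix.unitaryGroup (Fin 4) ℂ) :
    walkFun C 0 = shift ∘ₗ coinMul C := by
  have h : translate 0 = LinearMap.id := by
    refine LinearMap.ext fun u => ?_
    funext x; ext j
    have : phase 0 x j = 1 := by fin_cases j <;> simp [phase]
    simp [translate, this]
  simp [walkFun, h]

theorem walkFun_local (C : Site → Matrix.unitaryGroup (Fin 4) ℂ) (hC : TrivialOutsideSquare C)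
    (θ : ℂ) : ∃ B : ℝ, 0 ≤ B ∧ ∀ (u : Site → Spinor) (x : Site) (j : Fin 4),
      ‖walkFun C θ u x j‖ ≤ B * ‖u (x - step j)‖ := by
  obtain ⟨M, -, hM⟩ := hC
  let Ω : Finset Site := Finset.Icc (-(M : ℤ)) M ×ˢ Finset.Icc (-(M : ℤ)) M
  let b : Site → Fin 4 → ℝ := fun y j => ‖phase θ y j‖ *
    ∑ k, ‖(C y : Matrix (Fin 4) (Fin 4) ℂ) j k‖ * ‖phase (-θ) y k‖
  let e : ℝ := ‖Complex.exp (-(Complex.I * θ))‖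
  have hb : ∀ y j, 0 ≤ b y j := fun y j => by positivity
  refine ⟨e * (1 + ∑ y ∈ Ω, ∑ j, b y j), ?_, fun u x j => ?_⟩
  · have : 0 ≤ ∑ y ∈ Ω, ∑ j, b y j :=
      Finset.sum_nonneg fun y _ => Finset.sum_nonneg fun j _ => hb y j
    positivity
  · have hsum : 0 ≤ ∑ y ∈ Ω, ∑ j, b y j :=
      Finset.sum_nonneg fun y _ => Finset.sum_nonneg fun j _ => hb y j
    rw [walkFun_apply, phase_step θ x j, mul_assoc, norm_mul, mul_assoc]
    refine mul_le_mul_of_nonneg_left ?_ (norm_nonneg _)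
    generalize x - step j = y
    by_cases hy : |y.1| ≤ (M : ℤ) ∧ |y.2| ≤ (M : ℤ)
    · have hyΩ : y ∈ Ω := by
        simp only [Ω, Finset.mem_product, Finset.mem_Icc]
        exact ⟨abs_le.mp hy.1, abs_le.mp hy.2⟩
      have h1 : b y j ≤ ∑ y ∈ Ω, ∑ j, b y j :=
        (Finset.single_le_sum (f := b y) (fun k _ => hb y k) (Finset.mem_univ j)).trans
          (Finset.single_le_sum (f := fun y => ∑ j, b y j)
            (fun z _ => Finset.sum_nonneg fun k _ => hb z k) hyΩ)
      have h2 : ‖phase θ y j * ∑ k, (C y : Matrix (Fin 4) (Fin 4) ℂ) j k *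
          (phase (-θ) y k * u y k)‖ ≤ b y j * ‖u y‖ := by
        rw [norm_mul, mul_assoc, Finset.sum_mul]
        refine mul_le_mul_of_nonneg_left ((norm_sum_le _ _).trans ?_) (norm_nonneg _)
        refine Finset.sum_le_sum fun k _ => ?_
        rw [norm_mul, norm_mul, mul_assoc]
        have := PiLp.norm_apply_le (u y) k
        gcongr
      exact h2.trans (mul_le_mul_of_nonneg_right (by linarith) (norm_nonneg _))
    · have h1 : phase θ y j * ∑ k, (C y : Matrix (Fin 4) (Fin 4) ℂ) j k *
          (phase (-θ) y k * u y k) = u y j := by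
        rw [hM y hy]
        simp [Matrix.one_apply, ← mul_assoc, phase_neg_mul]
      rw [h1]
      have := PiLp.norm_apply_le (u y) j
      nlinarith [norm_nonneg (u y)]

theorem summable_sq (u : Hil) : Summable fun x => ‖u x‖ ^ 2 := by
  simpa using (lp.memℓp u).summable (by norm_num)

/-- A linear map on sequences whose `j`-th component at `x` is controlled by the value at
`x - step j` maps `ℓ²` boundedly to `ℓ²`. -/
theorem bounded_of_local (L : (Site → Spinor) →ₗ[ℂ] (Site → Spinor)) (B : ℝ) (hB : 0 ≤ B)
    (h : ∀ u x j, ‖L u x j‖ ≤ B * ‖u (x - step j)‖) (u : Hil) :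
    ∃ m : Memℓp (L u) 2, ‖(⟨L u, m⟩ : Hil)‖ ≤ 2 * B * ‖u‖ := by
  have hs : ∀ j, Summable fun x => (B * ‖u (x - step j)‖) ^ 2 := fun j => by
    simp only [mul_pow]
    exact (((Equiv.subRight (step j)).summable_iff).2 (summable_sq u)).mul_left _
  have hle : ∀ x, ‖L u x‖ ^ 2 ≤ ∑ j, (B * ‖u (x - step j)‖) ^ 2 := fun x => by
    rw [EuclideanSpace.norm_sq_eq]
    exact Finset.sum_le_sum fun j _ => pow_le_pow_left₀ (norm_nonneg _) (h _ x j) 2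
  have hS : Summable fun x => ∑ j, (B * ‖u (x - step j)‖) ^ 2 := summable_sum fun j _ => hs j
  have hL : Summable fun x => ‖L u x‖ ^ 2 :=
    Summable.of_nonneg_of_le (fun _ => sq_nonneg _) hle hS
  have m : Memℓp (L u) 2 := memℓp_gen (by simpa using hL)
  have nsq : ∀ v : Hil, ‖v‖ ^ 2 = ∑' x, ‖v x‖ ^ 2 := fun v => by
    simpa using lp.norm_rpow_eq_tsum (p := 2) (by norm_num) v
  refine ⟨m, ?_⟩
  refine le_of_sq_le_sq ?_ (by positivity)
  rw [nsq]
  calc ∑' x, ‖L u x‖ ^ 2 ≤ ∑' x, ∑ j, (B * ‖u (x - step j)‖) ^ 2 := hL.tsum_le_tsum hle hS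
    _ = ∑ j, ∑' x, (B * ‖u (x - step j)‖) ^ 2 := Summable.tsum_finsetSum fun j _ => hs j
    _ = ∑ _j : Fin 4, B ^ 2 * ‖u‖ ^ 2 := by
        refine Finset.sum_congr rfl fun j _ => ?_
        simp only [mul_pow]
        rw [tsum_mul_left, nsq]
        congr 1
        exact (Equiv.subRight (step j)).tsum_eq fun x => ‖u x‖ ^ 2
    _ = (2 * B * ‖u‖) ^ 2 := by
        simp; ring

/-- The bounded operator on `ℓ²` induced by a linear map on sequences. -/
def opOfLocal (L : (Site → Spinor) →ₗ[ℂ] (Site → Spinor))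
    (h : ∃ B : ℝ, 0 ≤ B ∧ ∀ u x j, ‖L u x j‖ ≤ B * ‖u (x - step j)‖) : Hil →L[ℂ] Hil :=
  LinearMap.mkContinuousOfExistsBound
    { toFun := fun u => ⟨L u, (bounded_of_local L h.choose h.choose_spec.1 h.choose_spec.2 u).1⟩
      map_add' := fun u v => Subtype.ext (L.map_add u v)
      map_smul' := fun c u => Subtype.ext (L.map_smul c u) }
    ⟨2 * h.choose, fun u =>
      (bounded_of_local L h.choose h.choose_spec.1 h.choose_spec.2 u).2⟩

/-- The time evolution operator `U = SC` on `ℓ²(ℤ²; ℂ⁴)`. -/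
def U (C : Site → Matrix.unitaryGroup (Fin 4) ℂ) (hC : TrivialOutsideSquare C) : Hil →L[ℂ] Hil :=
  opOfLocal (shift ∘ₗ coinMul C) (walkFun_zero C ▸ walkFun_local C hC 0)

/-- The complex translated operator `U(θ) = T(θ) U T(θ)⁻¹` on `ℓ²(ℤ²; ℂ⁴)`: it is bounded, since
`T(θ) S T(θ)⁻¹ = e^{-iθ} S` and the coin is trivial outside a finite set. -/
def Utheta (C : Site → Matrix.unitaryGroup (Fin 4) ℂ) (hC : TrivialOutsideSquare C) (θ : ℂ) :
    Hil →L[ℂ] Hil :=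
  opOfLocal (translate θ ∘ₗ shift ∘ₗ coinMul C ∘ₗ translate (-θ)) (walkFun_local C hC θ)

/-- `R(κ) = (U - e^{-iκ})⁻¹`. -/
def R (C : Site → Matrix.unitaryGroup (Fin 4) ℂ) (hC : TrivialOutsideSquare C) (κ : ℂ) :
    Hil →L[ℂ] Hil :=
  Ring.inverse (U C hC - Complex.exp (-(Complex.I * κ)) • 1)

/-- `R(κ, θ) = (U(θ) - e^{-iκ})⁻¹`. -/
def Rtheta (C : Site → Matrix.unitaryGroup (Fin 4) ℂ) (hC : TrivialOutsideSquare C) (κ θ : ℂ) :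
    Hil →L[ℂ] Hil :=
  Ring.inverse (Utheta C hC θ - Complex.exp (-(Complex.I * κ)) • 1)

/-- `⟨x⟩ = (1 + |x|²)^{1/2}`. -/
def bracket (x : Site) : ℝ := Real.sqrt (1 + (x.1 : ℝ) ^ 2 + (x.2 : ℝ) ^ 2)

/-- The class `𝒟` of super-exponentially decreasing sequences:
`e^{τ⟨·⟩} f ∈ ℓ²` for all `γ > 0` and `0 ≤ τ < γ`. -/
def D : Set Hil :=
  {f | ∀ γ : ℝ, 0 < γ → ∀ τ : ℝ, 0 ≤ τ → τ < γ →
    Memℓp (fun x => (Real.exp (τ * bracket x) : ℂ) • f x) 2}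

theorem norm_phase_le (θ : ℂ) (x : Site) (j : Fin 4) :
    ‖phase θ x j‖ ≤ Real.exp (|θ.im| * bracket x) := by
  have h1 : |(x.1 : ℝ)| ≤ bracket x := Real.abs_le_sqrt (by nlinarith [sq_nonneg (x.2 : ℝ)])
  have h2 : |(x.2 : ℝ)| ≤ bracket x := Real.abs_le_sqrt (by nlinarith [sq_nonneg (x.1 : ℝ)])
  have k1 := mul_le_mul_of_nonneg_left h1 (abs_nonneg θ.im)
  have k2 := mul_le_mul_of_nonneg_left h2 (abs_nonneg θ.im)
  rw [← abs_mul] at k1 k2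
  have a1 := abs_le.mp k1
  have a2 := abs_le.mp k2
  fin_cases j <;> simp [phase, Complex.norm_exp] <;> linarith

theorem memℓp_translate (θ : ℂ) {f : Hil} (hf : f ∈ D) : Memℓp (translate θ f) 2 := by
  have hm := hf (|θ.im| + 1) (by positivity) |θ.im| (abs_nonneg _) (by linarith)
  have hs : Summable fun x => ‖(Real.exp (|θ.im| * bracket x) : ℂ) • f x‖ ^ 2 := by
    simpa using hm.summable (by norm_num)
  refine memℓp_gen ?_
  have : Summable fun x => ‖translate θ f x‖ ^ 2 := by
    refine Summable.of_nonneg_of_le (fun _ => sq_nonneg _) (fun x => ?_) hs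
    rw [norm_smul, mul_pow, EuclideanSpace.norm_sq_eq, EuclideanSpace.norm_sq_eq, Finset.mul_sum]
    refine Finset.sum_le_sum fun j _ => ?_
    have h1 : translate θ f x j = phase θ x j * f x j := rfl
    rw [h1, norm_mul, mul_pow, Complex.norm_real, Real.norm_eq_abs, Real.abs_exp]
    have := norm_phase_le θ x j
    gcongr
  simpa using this

/-- `T(θ)f ∈ ℓ²(ℤ²; ℂ⁴)` for `f ∈ 𝒟`. -/
def T (θ : ℂ) (f : Hil) (hf : f ∈ D) : Hil := ⟨translate θ f, memℓp_translate θ hf⟩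

/-- `F_f(κ) = (R(κ)f, f)`, in the convention in which `(·,·)` is linear in the first variable. -/
def Ff (C : Site → Matrix.unitaryGroup (Fin 4) ℂ) (hC : TrivialOutsideSquare C) (f : Hil)
    (κ : ℂ) : ℂ :=
  inner ℂ f (R C hC κ f)

/-- `F` is a meromorphic extension of `F_f` from `Im κ > 0` to `Im κ > a`. Functions on the complex
torus `ℂ / 2πℤ` are functions on `ℂ` with period `2π`. -/
structure IsMeromorphicExtension (C : Site → Matrix.unitaryGroup (Fin 4) ℂ)
    (hC : TrivialOutsideSquare C) (f : Hil) (a : ℝ) (F : ℂ → ℂ) : Prop where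
  meromorphic : MeromorphicOn F {κ | a < κ.im}
  periodic : ∀ κ : ℂ, a < κ.im → F (κ + 2 * Real.pi) = F κ
  extends_Ff : ∀ κ : ℂ, 0 < κ.im → F κ = Ff C hC f κ

/-- The operator-valued function `A` is meromorphic at `κ₀` and the pole (if any) has finite rank:
`A(κ) = A₀(κ) + ∑_{k=1}^{N} (κ - κ₀)^{-k} B_k` near `κ₀`, with `A₀` analytic at `κ₀` and operators
`B_k` of finite rank. -/
def MeromorphicFiniteRankAt (A : ℂ → Hil →L[ℂ] Hil) (κ₀ : ℂ) : Prop :=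
  ∃ (N : ℕ) (B : Fin N → Hil →L[ℂ] Hil) (A₀ : ℂ → Hil →L[ℂ] Hil),
    (∀ k, FiniteDimensional ℂ (LinearMap.range (B k).toLinearMap)) ∧ AnalyticAt ℂ A₀ κ₀ ∧
    ∀ᶠ κ in 𝓝[≠] κ₀, A κ = A₀ κ + ∑ k : Fin N, ((κ - κ₀) ^ (k.val + 1))⁻¹ • B k

end QW

end

/-! Conjugation by `T(θ)` turns the free walk `S` into `e^{-iθ} S`, an operator that scales norms by
`e^{Im θ}`, while the coin only adds a finite-rank term. On `|z| > e^{Im θ}` the operator `U(θ) - z`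
is therefore a finite-rank perturbation of an invertible analytic family. Reduction to an `n × n`
determinant (`fredholm_finiteRank`) makes its inverse meromorphic in `κ`, with principal parts of
finite rank.

For `Im θ ≠ 0` the map `T(θ)` is unbounded, so `R(κ)` and `R(κ, θ)` are not conjugate operators on
`ℓ²`. The comparison is made on arbitrary sequences. A solution of `S C v = z v` that is `o(|z|ⁿ)`
along backward rays satisfies `S v = z v - g` with `g` finitely supported. The conjugated free
resolvent gives a solution of the same equation whose `T(θ)`-image is in `ℓ²`, and a difference of
two solutions, being an eigenfunction of `S` with this decay, vanishes. Hence `T(θ) v` is in `ℓ²`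
for every `θ` with `e^{Im θ} < |z|` (`memℓp_translate_of_backDecay`).

This moves eigenvectors from `θ₁` to `θ₂`. With `θ = 0`, and since the isometry `U` has no
eigenvalue with `|z| > 1`, it also gives `T(θ) R(κ) f = R(κ, θ) T(θ) f` for `Im κ > 0` wherever
`R(κ, θ)` exists. The matrix elements then agree in the upper half plane, and the identity theorem
for meromorphic functions carries the formula to every extension. -/

noncomputable section

namespace QW

/-! ### Laurent expansions with finite-rank coefficients -/

section FiniteRank

variable {E F G : Type*} [NormedAddCommGroup E] [NormedSpace ℂ E] [NormedAddCommGroup F]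
  [NormedSpace ℂ F] [NormedAddCommGroup G] [NormedSpace ℂ G]

theorem analyticAt_comp_clm {L : ℂ → F →L[ℂ] G} {A : ℂ → E →L[ℂ] F} {z : ℂ}
    (hL : AnalyticAt ℂ L z) (hA : AnalyticAt ℂ A z) :
    AnalyticAt ℂ (fun w => (L w).comp (A w)) z := by
  have h := (ContinuousLinearMap.compL ℂ E F G).analyticAt_bilinear (L z, A z)
  exact AnalyticAt.comp₂ (h := fun p : (F →L[ℂ] G) × (E →L[ℂ] F) => p.1.comp p.2)
    (by simpa using h) hL hA

/-- The divided difference has the shifted power series of `f` at `z`; it is used to split off one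
Taylor coefficient at a time. -/
theorem analyticAt_dslope_self {f : ℂ → E} {z : ℂ} (hf : AnalyticAt ℂ f z) :
    AnalyticAt ℂ (dslope f z) z := by
  obtain ⟨p, hp⟩ := hf
  exact hp.has_fpower_series_dslope_fslope.analyticAt

theorem eq_add_smul_dslope (f : ℂ → E) (z w : ℂ) : f w = f z + (w - z) • dslope f z w := by
  rw [sub_smul_dslope]; abel

/-- An analytic family of operators factoring analytically through a finite-dimensional space has
Taylor coefficients of finite rank. -/
theorem laurent_of_factor (N : ℕ) : ∀ {F : Type} [NormedAddCommGroup F] [NormedSpace ℂ F]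
    [FiniteDimensional ℂ F] {L : ℂ → F →L[ℂ] G} {A : ℂ → E →L[ℂ] F} {z : ℂ},
    AnalyticAt ℂ L z → AnalyticAt ℂ A z →
    ∃ (B : Fin N → E →L[ℂ] G) (A₀ : ℂ → E →L[ℂ] G),
      (∀ k, FiniteDimensional ℂ (LinearMap.range (B k).toLinearMap)) ∧ AnalyticAt ℂ A₀ z ∧
      ∀ w, w ≠ z → ((w - z) ^ N)⁻¹ • (L w).comp (A w) =
        A₀ w + ∑ k : Fin N, ((w - z) ^ (k.val + 1))⁻¹ • B k := by
  induction N with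
  | zero =>
    intro F _ _ _ L A z hL hA
    exact ⟨Fin.elim0, _, fun k => k.elim0, analyticAt_comp_clm hL hA, fun w _ => by simp⟩
  | succ N ih =>
    intro F _ _ _ L A z hL hA
    -- The remainder `(L(w)A(w) - L(z)A(z)) / (w - z)` is the row `[dslope L, L(z)]` times the
    -- column `[A(w), dslope A]`. It thus factors analytically through `F × F`, which is why the
    -- induction quantifies over `F`.
    have hL' : AnalyticAt ℂ (fun w => (dslope L z w).comp (ContinuousLinearMap.fst ℂ F F) +
        (L z).comp (ContinuousLinearMap.snd ℂ F F)) z :=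
      (analyticAt_comp_clm (analyticAt_dslope_self hL) analyticAt_const).add analyticAt_const
    have hA' : AnalyticAt ℂ (fun w => (ContinuousLinearMap.inl ℂ F F).comp (A w) +
        (ContinuousLinearMap.inr ℂ F F).comp (dslope A z w)) z :=
      (analyticAt_comp_clm analyticAt_const hA).add
        (analyticAt_comp_clm analyticAt_const (analyticAt_dslope_self hA))
    obtain ⟨B, A₀, hB, hA₀, h⟩ := ih hL' hA'
    -- The value at `z` becomes the coefficient of the highest-order term `(w - z)^{-(N+1)}`.
    refine ⟨Fin.snoc B ((L z).comp (A z)), A₀, fun k => ?_, hA₀, fun w hw => ?_⟩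
    · refine Fin.lastCases ?_ (fun i => ?_) k
      · rw [Fin.snoc_last]
        have : LinearMap.range ((L z).comp (A z)).toLinearMap ≤
            LinearMap.range (L z).toLinearMap := by
          rintro _ ⟨x, rfl⟩
          exact ⟨A z x, rfl⟩
        exact Submodule.finiteDimensional_of_le this
      · rw [Fin.snoc_castSucc]
        exact hB i
    · have hne : w - z ≠ 0 := sub_ne_zero.2 hw
      have key : (L w).comp (A w) = (L z).comp (A z) + (w - z) •
          ((dslope L z w).comp (ContinuousLinearMap.fst ℂ F F) +
            (L z).comp (ContinuousLinearMap.snd ℂ F F)).comp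
          ((ContinuousLinearMap.inl ℂ F F).comp (A w) +
            (ContinuousLinearMap.inr ℂ F F).comp (dslope A z w)) := by
        ext x
        have h1 := eq_add_smul_dslope L z w
        have h2 := eq_add_smul_dslope A z w
        have h3 : (A w) x = (A z) x + (w - z) • (dslope A z w) x :=
          DFunLike.congr_fun h2 x
        have h4 : L w (A w x) = L z (A w x) + (w - z) • dslope L z w (A w x) :=
          DFunLike.congr_fun h1 (A w x)
        simp only [ContinuousLinearMap.comp_apply, add_apply,
          smul_apply, map_add, ContinuousLinearMap.inl_apply,
          ContinuousLinearMap.inr_apply, ContinuousLinearMap.coe_fst',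
          ContinuousLinearMap.coe_snd', map_zero]
        rw [h4]
        nth_rw 1 [h3]
        simp only [map_add, map_smul, smul_add, add_zero, zero_add]
        abel
      rw [Fin.sum_univ_castSucc, key, smul_add, smul_smul]
      have : ((w - z) ^ (N + 1))⁻¹ * (w - z) = ((w - z) ^ N)⁻¹ := by
        rw [pow_succ]
        field_simp
      rw [this, h w hw]
      simp only [Fin.snoc_castSucc, Fin.snoc_last, Fin.val_castSucc, Fin.val_last]
      abel

end FiniteRank

/-! ### Analytic Fredholm theory by determinants -/

section Perturbation

variable {H : Type*} [NormedAddCommGroup H] [NormedSpace ℂ H]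

/-- A bounded operator of finite rank factors through some `ℂⁿ`. -/
theorem exists_factor_of_finiteRank (D : H →L[ℂ] H)
    (hD : FiniteDimensional ℂ (LinearMap.range D.toLinearMap)) :
    ∃ (n : ℕ) (J : (Fin n → ℂ) →L[ℂ] H) (B : H →L[ℂ] (Fin n → ℂ)), D = J.comp B := by
  let W := LinearMap.range D.toLinearMap
  let e : W ≃L[ℂ] (Fin (Module.finrank ℂ W) → ℂ) := ContinuousLinearEquiv.ofFinrankEq (by simp)
  refine ⟨Module.finrank ℂ W, W.subtypeL.comp (e.symm : _ →L[ℂ] W),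
    (e : W →L[ℂ] (Fin (Module.finrank ℂ W) → ℂ)).comp (D.codRestrict W fun x => ⟨x, rfl⟩), ?_⟩
  ext x
  simp only [ContinuousLinearMap.comp_apply, ContinuousLinearEquiv.coe_coe,
    ContinuousLinearEquiv.symm_apply_apply]
  rfl

variable {n : ℕ}

/-- The bounded operator on `ℂⁿ` with a given matrix. -/
def matCLM (m : Matrix (Fin n) (Fin n) ℂ) : (Fin n → ℂ) →L[ℂ] (Fin n → ℂ) :=
  LinearMap.toContinuousLinearMap (Matrix.toLin' m)

/-- Reduces analyticity of an operator on `ℂⁿ` to that of its matrix entries. -/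
theorem matCLM_eq_sum (m : Matrix (Fin n) (Fin n) ℂ) :
    matCLM m = ∑ i, ∑ k, m i k • matCLM (Matrix.single i k 1) := by
  have h : ∀ m : Matrix (Fin n) (Fin n) ℂ,
      matCLM m = (LinearMap.toContinuousLinearMap.toLinearMap ∘ₗ Matrix.toLin'.toLinearMap) m :=
    fun _ => rfl
  simp only [h, ← map_smul, ← map_sum]
  congr 1
  conv_lhs => rw [Matrix.matrix_eq_sum_single m]
  simp [Matrix.smul_single]

/-- The matrix of a bounded operator on `ℂⁿ`. -/
def matOf (M : (Fin n → ℂ) →L[ℂ] (Fin n → ℂ)) : Matrix (Fin n) (Fin n) ℂ :=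
  LinearMap.toMatrix' M.toLinearMap

theorem matCLM_matOf (M : (Fin n → ℂ) →L[ℂ] (Fin n → ℂ)) : matCLM (matOf M) = M := by
  ext x; simp [matCLM, matOf]

theorem matCLM_mul (m m' : Matrix (Fin n) (Fin n) ℂ) :
    matCLM (m * m') = (matCLM m).comp (matCLM m') := by
  ext x; simp [matCLM, Matrix.toLin'_mul]

theorem matCLM_smul_one (c : ℂ) :
    matCLM (c • (1 : Matrix (Fin n) (Fin n) ℂ)) = c • 1 := by
  ext x; simp [matCLM]

theorem comp_adjugate (M : (Fin n → ℂ) →L[ℂ] (Fin n → ℂ)) :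
    M.comp (matCLM (matOf M).adjugate) = (matOf M).det • 1 := by
  rw [← matCLM_smul_one, ← Matrix.mul_adjugate, matCLM_mul, matCLM_matOf]

theorem adjugate_comp (M : (Fin n → ℂ) →L[ℂ] (Fin n → ℂ)) :
    (matCLM (matOf M).adjugate).comp M = (matOf M).det • 1 := by
  rw [← matCLM_smul_one, ← Matrix.adjugate_mul, matCLM_mul, matCLM_matOf]

theorem det_matOf_ne_zero {M : (Fin n → ℂ) →L[ℂ] (Fin n → ℂ)} (hM : ∀ c, M c = 0 → c = 0) :
    (matOf M).det ≠ 0 := by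
  intro h
  obtain ⟨v, hv, h0⟩ := Matrix.exists_mulVec_eq_zero_iff.2 h
  refine hv (hM v ?_)
  rw [← h0, matOf, LinearMap.toMatrix'_mulVec]
  rfl

theorem analyticAt_matOf_apply {M : ℂ → (Fin n → ℂ) →L[ℂ] (Fin n → ℂ)} {z : ℂ}
    (hM : AnalyticAt ℂ M z) (i k : Fin n) : AnalyticAt ℂ (fun w => matOf (M w) i k) z := by
  let ev : ((Fin n → ℂ) →L[ℂ] (Fin n → ℂ)) →L[ℂ] ℂ :=
    (ContinuousLinearMap.proj (R := ℂ) (φ := fun _ : Fin n => ℂ) i).comp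
      (ContinuousLinearMap.apply ℂ _ (Pi.single k 1))
  have h : (fun w => matOf (M w) i k) = fun w => ev (M w) := by
    funext w
    simp [matOf, ev, LinearMap.toMatrix'_apply, Pi.single]
  rw [h]
  exact (ev.analyticAt _).comp hM

theorem analyticAt_det {m : ℂ → Matrix (Fin n) (Fin n) ℂ} {z : ℂ}
    (hm : ∀ i k, AnalyticAt ℂ (fun w => m w i k) z) : AnalyticAt ℂ (fun w => (m w).det) z := by
  simp only [Matrix.det_apply']
  refine Finset.analyticAt_fun_sum _ fun σ _ => analyticAt_const.mul ?_
  exact Finset.analyticAt_fun_prod _ fun i _ => hm _ _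

theorem analyticAt_adjugate {m : ℂ → Matrix (Fin n) (Fin n) ℂ} {z : ℂ}
    (hm : ∀ i k, AnalyticAt ℂ (fun w => m w i k) z) :
    AnalyticAt ℂ (fun w => matCLM (m w).adjugate) z := by
  have h : (fun w => matCLM (m w).adjugate) =
      fun w => ∑ i, ∑ k, (m w).adjugate i k • matCLM (Matrix.single i k 1) :=
    funext fun w => matCLM_eq_sum _
  rw [h]
  refine Finset.analyticAt_fun_sum _ fun i _ => Finset.analyticAt_fun_sum _ fun k _ =>
    AnalyticAt.fun_smul ?_ analyticAt_const
  simp only [Matrix.adjugate_apply]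
  refine analyticAt_det fun i' k' => ?_
  simp only [Matrix.updateRow_apply]
  split_ifs
  · exact analyticAt_const
  · exact hm _ _

theorem isUnit_clm_of_comp {A B : H →L[ℂ] H} (h₁ : A.comp B = 1) (h₂ : B.comp A = 1) :
    IsUnit A ∧ Ring.inverse A = B := by
  let u : (H →L[ℂ] H)ˣ := ⟨A, B, h₁, h₂⟩
  exact ⟨⟨u, rfl⟩, Ring.inverse_unit u⟩

/-- The inverse of a finite-rank perturbation of an invertible operator. -/
theorem inverse_add_finiteRank {A G : H →L[ℂ] H} (h₁ : A.comp G = 1) (h₂ : G.comp A = 1)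
    (J : (Fin n → ℂ) →L[ℂ] H) (B : H →L[ℂ] (Fin n → ℂ)) {d : ℂ}
    {N : (Fin n → ℂ) →L[ℂ] (Fin n → ℂ)} (hd : d ≠ 0)
    (hN₁ : (1 + B.comp (G.comp J)).comp N = d • 1) (hN₂ : N.comp (1 + B.comp (G.comp J)) = d • 1) :
    IsUnit (A + J.comp B) ∧
      Ring.inverse (A + J.comp B) = G - d⁻¹ • (G.comp (J.comp N)).comp (B.comp G) := by
  have a₁ : ∀ x, A (G x) = x := fun x => DFunLike.congr_fun h₁ x
  have a₂ : ∀ x, G (A x) = x := fun x => DFunLike.congr_fun h₂ x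
  -- The operator `d⁻¹ N` inverts `1 + B G J`, so the claimed inverse is the Woodbury formula; these
  -- two identities are what its verification needs.
  have b₁ : ∀ c, B (G (J (N c))) = d • c - N c := fun c => by
    have := DFunLike.congr_fun hN₁ c
    simp at this
    rw [← this]; abel
  have b₂ : ∀ c, N (B (G (J c))) = d • c - N c := fun c => by
    have := DFunLike.congr_fun hN₂ c
    simp at this
    rw [← this]; abel
  refine isUnit_clm_of_comp ?_ ?_
  · ext x
    simp [a₁, b₁, smul_sub, smul_smul, hd]
  · ext x
    simp [a₂, b₂, smul_sub, smul_smul, hd]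

variable [CompleteSpace H]

/-- Analytic Fredholm theory for finite-rank perturbations. -/
theorem fredholm_finiteRank {V : Set ℂ} (hVo : IsOpen V) (hVc : IsPreconnected V)
    {A : ℂ → H →L[ℂ] H} (hA : AnalyticOnNhd ℂ A V) (hAu : ∀ z ∈ V, IsUnit (A z))
    (D : H →L[ℂ] H) (hD : FiniteDimensional ℂ (LinearMap.range D.toLinearMap))
    (hex : ∃ z ∈ V, IsUnit (A z + D)) {z₀ : ℂ} (hz₀ : z₀ ∈ V) :
    (∀ᶠ z in 𝓝[≠] z₀, IsUnit (A z + D)) ∧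
    ∃ (N : ℕ) (B : Fin N → H →L[ℂ] H) (A₀ : ℂ → H →L[ℂ] H),
      (∀ k, FiniteDimensional ℂ (LinearMap.range (B k).toLinearMap)) ∧ AnalyticAt ℂ A₀ z₀ ∧
      ∀ᶠ z in 𝓝[≠] z₀, Ring.inverse (A z + D) =
        A₀ z + ∑ k : Fin N, ((z - z₀) ^ (k.val + 1))⁻¹ • B k := by
  obtain ⟨n, J, B, rfl⟩ := exists_factor_of_finiteRank D hD
  let G : ℂ → H →L[ℂ] H := fun z => Ring.inverse (A z)
  have hG : ∀ z ∈ V, AnalyticAt ℂ G z := fun z hz => by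
    obtain ⟨u, hu⟩ := hAu z hz
    have := analyticAt_inverse (𝕜 := ℂ) u
    rw [hu] at this
    exact this.comp (hA z hz)
  have g₁ : ∀ z ∈ V, (A z).comp (G z) = 1 := fun z hz => Ring.mul_inverse_cancel _ (hAu z hz)
  have g₂ : ∀ z ∈ V, (G z).comp (A z) = 1 := fun z hz => Ring.inverse_mul_cancel _ (hAu z hz)
  let M : ℂ → (Fin n → ℂ) →L[ℂ] (Fin n → ℂ) := fun z => 1 + B.comp ((G z).comp J)
  have hM : ∀ z ∈ V, AnalyticAt ℂ M z := fun z hz =>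
    analyticAt_const.add
      (analyticAt_comp_clm analyticAt_const (analyticAt_comp_clm (hG z hz) analyticAt_const))
  let d : ℂ → ℂ := fun z => (matOf (M z)).det
  let N : ℂ → (Fin n → ℂ) →L[ℂ] (Fin n → ℂ) := fun z => matCLM (matOf (M z)).adjugate
  have hd : AnalyticOnNhd ℂ d V := fun z hz =>
    analyticAt_det fun i k => analyticAt_matOf_apply (hM z hz) i k
  have hN : ∀ z ∈ V, AnalyticAt ℂ N z := fun z hz =>
    analyticAt_adjugate fun i k => analyticAt_matOf_apply (hM z hz) i k
  have hinv : ∀ z ∈ V, d z ≠ 0 → IsUnit (A z + J.comp B) ∧ Ring.inverse (A z + J.comp B) =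
      G z - (d z)⁻¹ • ((G z).comp (J.comp (N z))).comp (B.comp (G z)) := fun z hz h =>
    inverse_add_finiteRank (g₁ z hz) (g₂ z hz) J B h (comp_adjugate (M z)) (adjugate_comp (M z))
  -- If `d` vanished near `z₀` it would vanish on all of `V`. At the point where `A + D` is
  -- invertible this is impossible: a vector `c` with `M c = 0` gives `G J c` in the kernel of `A +
  -- D`, so `G J c = 0`, and then `c = -B G J c = 0`.
  have hnz : ¬ ∀ᶠ z in 𝓝 z₀, d z = 0 := fun h0 => by
    obtain ⟨z, hz, hu⟩ := hex
    have hdz : d z = 0 := hd.eqOn_zero_of_preconnected_of_eventuallyEq_zero hVc hz₀ h0 hz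
    refine det_matOf_ne_zero (M := M z) (fun c hc => ?_) hdz
    have hc' : c + B (G z (J c)) = 0 := hc
    have a₁ : A z (G z (J c)) = J c := DFunLike.congr_fun (g₁ z hz) (J c)
    have hker : (A z + J.comp B) (G z (J c)) = 0 := by
      simp only [add_apply, ContinuousLinearMap.comp_apply, a₁]
      rw [← map_add, hc', map_zero]
    obtain ⟨u, hu⟩ := hu
    have h0 : G z (J c) = 0 := by
      have h1 : (u⁻¹ : (H →L[ℂ] H)ˣ).val ((u : H →L[ℂ] H) (G z (J c))) = G z (J c) :=
        DFunLike.congr_fun (u.inv_mul) (G z (J c))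
      rw [← h1, hu, hker, map_zero]
    rw [h0, map_zero, add_zero] at hc'
    exact hc'
  have hVn : ∀ᶠ z in 𝓝[≠] z₀, z ∈ V := eventually_nhdsWithin_of_eventually_nhds (hVo.mem_nhds hz₀)
  have hdne : ∀ᶠ z in 𝓝[≠] z₀, d z ≠ 0 :=
    (hd z₀ hz₀).eventually_eq_zero_or_eventually_ne_zero.resolve_left hnz
  refine ⟨by filter_upwards [hVn, hdne] with z h1 h2 using (hinv z h1 h2).1, ?_⟩
  -- Only the zero of order `p` of the determinant creates a pole. The unit `h` is absorbed into the
  -- left factor, leaving a product through `ℂⁿ` divided by `(z - z₀)^p`.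
  obtain ⟨p, h, hh, hh0, hdh⟩ := (hd z₀ hz₀).exists_eventuallyEq_pow_smul_nonzero_iff.2 hnz
  have hLan : AnalyticAt ℂ (fun z => -(h z)⁻¹ • (G z).comp (J.comp (N z))) z₀ :=
    (hh.inv hh0).neg.smul (analyticAt_comp_clm (hG z₀ hz₀)
      (analyticAt_comp_clm analyticAt_const (hN z₀ hz₀)))
  have hRan : AnalyticAt ℂ (fun z => B.comp (G z)) z₀ :=
    analyticAt_comp_clm analyticAt_const (hG z₀ hz₀)
  obtain ⟨P, A₀, hP, hA₀, hL⟩ := laurent_of_factor p hLan hRan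
  refine ⟨p, P, fun z => G z + A₀ z, hP, (hG z₀ hz₀).add hA₀, ?_⟩
  filter_upwards [hVn, hdne, eventually_nhdsWithin_of_eventually_nhds hdh, self_mem_nhdsWithin]
    with z h1 h2 h3 h4
  rw [(hinv z h1 h2).2, add_assoc, ← hL z h4, h3, smul_eq_mul, mul_inv]
  ext x
  simp [smul_smul, sub_eq_add_neg]

end Perturbation

/-! ### Norms of the walks and the finite-rank perturbation -/

theorem shift_apply (u : Site → Spinor) (x : Site) (j : Fin 4) :
    shift u x j = u (x - step j) j := rfl

theorem coinMul_apply (C : Site → Matrix.unitaryGroup (Fin 4) ℂ) (u : Site → Spinor) (x : Site) :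
    coinMul C u x = WithLp.toLp 2 ((C x : Matrix (Fin 4) (Fin 4) ℂ).mulVec (u x)) := rfl

theorem translate_apply (θ : ℂ) (u : Site → Spinor) (x : Site) (j : Fin 4) :
    translate θ u x j = phase θ x j * u x j := rfl

theorem phase_mul_phase_neg (θ : ℂ) (x : Site) (j : Fin 4) : phase (-θ) x j * phase θ x j = 1 := by
  rw [mul_comm, phase_neg_mul]

theorem translate_translate_neg (θ : ℂ) (u : Site → Spinor) :
    translate θ (translate (-θ) u) = u := by
  funext x; ext j
  rw [translate_apply, translate_apply, ← mul_assoc, phase_neg_mul, one_mul]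

theorem translate_neg_translate (θ : ℂ) (u : Site → Spinor) :
    translate (-θ) (translate θ u) = u := by
  funext x; ext j
  rw [translate_apply, translate_apply, ← mul_assoc, phase_mul_phase_neg, one_mul]

theorem translate_injective (θ : ℂ) : Function.Injective (translate θ) :=
  Function.LeftInverse.injective (translate_neg_translate θ)

theorem translate_zero (u : Site → Spinor) : translate 0 u = u := by
  funext x; ext j
  have : phase 0 x j = 1 := by fin_cases j <;> simp [phase]
  rw [translate_apply, this, one_mul]

theorem walkFun_translate (C : Site → Matrix.unitaryGroup (Fin 4) ℂ) (θ : ℂ) (v : Site → Spinor) :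
    walkFun C θ (translate θ v) = translate θ (shift (coinMul C v)) := by
  simp [walkFun, translate_neg_translate]

theorem norm_sq_eq_tsum (v : Hil) : ‖v‖ ^ 2 = ∑' x, ‖v x‖ ^ 2 := by
  simpa using lp.norm_rpow_eq_tsum (p := 2) (by norm_num) v

theorem norm_coinMul (C : Site → Matrix.unitaryGroup (Fin 4) ℂ) (u : Site → Spinor) (x : Site) :
    ‖coinMul C u x‖ = ‖u x‖ := by
  have h : ‖coinMul C u x‖ ^ 2 = ‖u x‖ ^ 2 := by
    rw [← Complex.ofReal_inj, Complex.ofReal_pow, Complex.ofReal_pow,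
      ← RCLike.ofReal_eq_complex_ofReal, ← inner_self_eq_norm_sq_to_K (𝕜 := ℂ),
      ← inner_self_eq_norm_sq_to_K (𝕜 := ℂ), coinMul_apply,
      EuclideanSpace.inner_eq_star_dotProduct, EuclideanSpace.inner_eq_star_dotProduct]
    have hu : (C x : Matrix (Fin 4) (Fin 4) ℂ).conjTranspose *
        (C x : Matrix (Fin 4) (Fin 4) ℂ) = 1 :=
      Matrix.UnitaryGroup.star_mul_self (C x)
    simp only
    rw [Matrix.star_mulVec, dotProduct_comm, ← Matrix.dotProduct_mulVec, Matrix.mulVec_mulVec, hu,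
      Matrix.one_mulVec, dotProduct_comm]
  exact (sq_eq_sq₀ (norm_nonneg _) (norm_nonneg _)).1 h

/-- Each component is translated by its own step, so the square sum is reindexed separately for
every `j`. This covers `U` (with `w = C u`, `c = 1`) and the free walk (with `w = u`, `c =
e^{-iθ}`). -/
theorem norm_eq_of_shift {u v : Hil} {w : Site → Spinor} {c : ℂ} (hw : ∀ x, ‖w x‖ = ‖u x‖)
    (hv : ∀ x j, v x j = c * w (x - step j) j) : ‖v‖ = ‖c‖ * ‖u‖ := by
  have hs : ∀ j, Summable fun x => ‖w x j‖ ^ 2 := fun j =>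
    Summable.of_nonneg_of_le (fun _ => sq_nonneg _)
      (fun x => pow_le_pow_left₀ (norm_nonneg _)
        ((PiLp.norm_apply_le (w x) j).trans_eq (hw x)) 2) (summable_sq u)
  have hs' : ∀ j, Summable fun x => ‖w (x - step j) j‖ ^ 2 := fun j =>
    ((Equiv.subRight (step j)).summable_iff (f := fun x => ‖w x j‖ ^ 2)).2 (hs j)
  have h : ‖v‖ ^ 2 = (‖c‖ * ‖u‖) ^ 2 := by
    rw [mul_pow, norm_sq_eq_tsum, norm_sq_eq_tsum]
    calc ∑' x, ‖v x‖ ^ 2 = ∑' x, ∑ j, ‖c‖ ^ 2 * ‖w (x - step j) j‖ ^ 2 := by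
          refine tsum_congr fun x => ?_
          rw [EuclideanSpace.norm_sq_eq]
          exact Finset.sum_congr rfl fun j _ => by rw [hv, norm_mul, mul_pow]
      _ = ∑ j, ∑' x, ‖c‖ ^ 2 * ‖w (x - step j) j‖ ^ 2 :=
          Summable.tsum_finsetSum fun j _ => (hs' j).mul_left _
      _ = ∑ j, ∑' x, ‖c‖ ^ 2 * ‖w x j‖ ^ 2 :=
          Finset.sum_congr rfl fun j _ =>
            (Equiv.subRight (step j)).tsum_eq fun x => ‖c‖ ^ 2 * ‖w x j‖ ^ 2
      _ = ∑' x, ∑ j, ‖c‖ ^ 2 * ‖w x j‖ ^ 2 :=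
          (Summable.tsum_finsetSum fun j _ => (hs j).mul_left _).symm
      _ = ∑' x, ‖c‖ ^ 2 * ‖u x‖ ^ 2 := by
          refine tsum_congr fun x => ?_
          rw [← Finset.mul_sum, ← EuclideanSpace.norm_sq_eq, hw]
      _ = ‖c‖ ^ 2 * ∑' x, ‖u x‖ ^ 2 := tsum_mul_left
  exact (sq_eq_sq₀ (norm_nonneg _) (by positivity)).1 h

theorem norm_U_apply (C : Site → Matrix.unitaryGroup (Fin 4) ℂ) (hC : TrivialOutsideSquare C)
    (u : Hil) : ‖U C hC u‖ = ‖u‖ := by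
  have := norm_eq_of_shift (u := u) (v := U C hC u) (w := coinMul C u) (c := 1)
    (norm_coinMul C u) (fun x j => (one_mul _).symm)
  simpa using this

theorem isUnit_sub_of_norm_le {A : Hil →L[ℂ] Hil} {r : ℝ} (hr : 0 ≤ r)
    (hA : ∀ u, ‖A u‖ ≤ r * ‖u‖) {z : ℂ} (hz : r < ‖z‖) : IsUnit (A - z • 1) := by
  have h : z ∈ resolventSet ℂ A := spectrum.mem_resolventSet_of_norm_lt_mul (by
    have h1 : ‖A‖ ≤ r := A.opNorm_le_bound hr hA
    have h2 : ‖(1 : Hil →L[ℂ] Hil)‖ ≤ 1 := ContinuousLinearMap.norm_id_le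
    nlinarith [norm_nonneg A, norm_nonneg (1 : Hil →L[ℂ] Hil)])
  rw [spectrum.mem_resolventSet_iff] at h
  have := h.neg
  rwa [neg_sub, Algebra.algebraMap_eq_smul_one] at this

theorem norm_exp_neg_I_mul (κ : ℂ) : ‖Complex.exp (-(Complex.I * κ))‖ = Real.exp κ.im := by
  simp [Complex.norm_exp]

theorem isUnit_U_sub (C : Site → Matrix.unitaryGroup (Fin 4) ℂ) (hC : TrivialOutsideSquare C)
    {z : ℂ} (hz : 1 < ‖z‖) : IsUnit (U C hC - z • 1) :=
  isUnit_sub_of_norm_le zero_le_one (fun u => by rw [norm_U_apply, one_mul]) hz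

theorem trivialOutsideSquare_one :
    TrivialOutsideSquare (1 : Site → Matrix.unitaryGroup (Fin 4) ℂ) :=
  ⟨1, one_pos, fun _ _ => rfl⟩

/-- The free walk `U₀(θ) = e^{-iθ} S`. -/
def freeWalk (θ : ℂ) : Hil →L[ℂ] Hil := Utheta 1 trivialOutsideSquare_one θ

theorem coinMul_one (u : Site → Spinor) : coinMul 1 u = u := by
  funext x; ext j
  simp [coinMul_apply]

theorem coe_freeWalk (θ : ℂ) (u : Hil) :
    (freeWalk θ u : Site → Spinor) = translate θ (shift (translate (-θ) u)) := by
  have h : (freeWalk θ u : Site → Spinor) =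
    translate θ (shift (coinMul 1 (translate (-θ) u))) := rfl
  rw [h, coinMul_one]

theorem norm_freeWalk_apply (θ : ℂ) (u : Hil) : ‖freeWalk θ u‖ = Real.exp θ.im * ‖u‖ := by
  rw [← norm_exp_neg_I_mul]
  refine norm_eq_of_shift (w := u) (fun _ => rfl) fun x j => ?_
  rw [coe_freeWalk, translate_apply, shift_apply, translate_apply, phase_step, mul_assoc,
    ← mul_assoc (phase θ _ j), phase_neg_mul, one_mul]

theorem isUnit_freeWalk_sub (θ : ℂ) {z : ℂ} (hz : Real.exp θ.im < ‖z‖) :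
    IsUnit (freeWalk θ - z • 1) :=
  isUnit_sub_of_norm_le (Real.exp_pos _).le (fun u => (norm_freeWalk_apply θ u).le) hz

/-- The effect of the coin is supported in a finite set. -/
theorem shift_coinMul_eq (C : Site → Matrix.unitaryGroup (Fin 4) ℂ)
    (hC : TrivialOutsideSquare C) : ∃ Ω : Finset Site, ∀ (u : Site → Spinor) (x : Site),
      x ∉ Ω → shift (coinMul C u) x = shift u x := by
  obtain ⟨M, -, hM⟩ := hC
  -- The square is enlarged by one because the value at `x` uses the coin at the neighbours `x -
  -- step j`.
  refine ⟨Finset.Icc (-(M : ℤ) - 1) (M + 1) ×ˢ Finset.Icc (-(M : ℤ) - 1) (M + 1),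
    fun u x hx => ?_⟩
  ext j
  have hout : ¬ (|(x - step j).1| ≤ (M : ℤ) ∧ |(x - step j).2| ≤ (M : ℤ)) := by
    rintro ⟨h1, h2⟩
    refine hx ?_
    rw [abs_le] at h1 h2
    simp only [Finset.mem_product, Finset.mem_Icc]
    fin_cases j <;> simp [step] at h1 h2 <;> omega
  rw [shift_apply, shift_apply, coinMul_apply, hM _ hout]
  simp

theorem memℓp_of_finite_support {v : Site → Spinor} (Ω : Finset Site) (h : ∀ x ∉ Ω, v x = 0) :
    Memℓp v 2 := by
  refine memℓp_gen (summable_of_ne_finset_zero (s := Ω) fun x hx => ?_)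
  rw [h x hx]
  simp

theorem translate_apply_eq_zero (θ : ℂ) {u : Site → Spinor} {x : Site} (h : u x = 0) :
    translate θ u x = 0 := by
  ext j
  rw [translate_apply, h]
  simp

/-- The perturbation `U(θ) - U₀(θ)` has finite rank. -/
theorem finiteDimensional_range_Utheta_sub (C : Site → Matrix.unitaryGroup (Fin 4) ℂ)
    (hC : TrivialOutsideSquare C) (θ : ℂ) :
    FiniteDimensional ℂ (LinearMap.range (Utheta C hC θ - freeWalk θ).toLinearMap) := by
  obtain ⟨Ω, hΩ⟩ := shift_coinMul_eq C hC
  have hsupp : ∀ v ∈ LinearMap.range (Utheta C hC θ - freeWalk θ).toLinearMap,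
      ∀ x ∉ Ω, (v : Site → Spinor) x = 0 := by
    rintro _ ⟨u, rfl⟩ x hx
    have h1 : (((Utheta C hC θ - freeWalk θ) u : Hil) : Site → Spinor) =
        translate θ (shift (coinMul C (translate (-θ) u)) - shift (translate (-θ) u)) := by
      rw [map_sub, ← coe_freeWalk]
      rfl
    have h2 : (((Utheta C hC θ - freeWalk θ) u : Hil) : Site → Spinor) x = 0 := by
      rw [h1]
      refine translate_apply_eq_zero θ ?_
      rw [Pi.sub_apply, hΩ _ _ hx, sub_self]
    exact h2
  let φ : LinearMap.range (Utheta C hC θ - freeWalk θ).toLinearMap →ₗ[ℂ] (Ω → Spinor) :=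
    { toFun := fun v x => (v : Hil) x
      map_add' := fun _ _ => rfl
      map_smul' := fun _ _ => rfl }
  refine FiniteDimensional.of_injective φ fun v w hvw => ?_
  refine Subtype.ext (lp.ext (funext fun x => ?_))
  by_cases hx : x ∈ Ω
  · exact congrFun hvw ⟨x, hx⟩
  · rw [hsupp v v.2 x hx, hsupp w w.2 x hx]

/-! ### Decay along backward rays; independence of eigenvalues from `θ` -/

theorem phase_sub_nsmul (θ : ℂ) (x : Site) (j : Fin 4) (n : ℕ) :
    phase θ x j = Complex.exp (-(Complex.I * θ)) ^ n * phase θ (x - n • step j) j := by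
  induction n with
  | zero => simp
  | succ n ih =>
    rw [ih, phase_step θ (x - n • step j), pow_succ, mul_assoc, succ_nsmul, sub_sub]

/-- `v` grows slower than `|z|ⁿ` along the backward rays of the walk. -/
def BackDecay (z : ℂ) (v : Site → Spinor) : Prop :=
  ∀ x j, Tendsto (fun n : ℕ => (z ^ n)⁻¹ * v (x - n • step j) j) atTop (𝓝 0)

theorem BackDecay.sub {z : ℂ} {v w : Site → Spinor} (hv : BackDecay z v) (hw : BackDecay z w) :
    BackDecay z (v - w) := fun x j => by
  simpa [mul_sub] using (hv x j).sub (hw x j)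

/-- Each backward step multiplies the weight of `T(-θ)` by `e^{Im θ}` in modulus, while `w` is
bounded by its norm, so the ratio `e^{Im θ} / |z| < 1` decides. -/
theorem backDecay_translate_neg {z θ : ℂ} (hz : Real.exp θ.im < ‖z‖) (w : Hil) :
    BackDecay z (translate (-θ) w) := fun x j => by
  have hz0 : 0 < ‖z‖ := (Real.exp_pos _).trans hz
  have hlim : Tendsto (fun n : ℕ => (Real.exp θ.im / ‖z‖) ^ n * (‖phase (-θ) x j‖ * ‖w‖))
      atTop (𝓝 0) := by
    simpa using (tendsto_pow_atTop_nhds_zero_of_lt_one (by positivity)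
      ((div_lt_one hz0).2 hz)).mul_const (‖phase (-θ) x j‖ * ‖w‖)
  refine squeeze_zero_norm (fun n => ?_) hlim
  have h1 : ‖phase (-θ) (x - n • step j) j‖ = Real.exp θ.im ^ n * ‖phase (-θ) x j‖ := by
    have h2 := phase_sub_nsmul (-θ) x j n
    rw [h2, norm_mul, norm_pow, norm_exp_neg_I_mul, ← mul_assoc, ← mul_pow, ← Real.exp_add]
    simp
  have h3 : ‖w (x - n • step j) j‖ ≤ ‖w‖ :=
    (PiLp.norm_apply_le _ j).trans (lp.norm_apply_le_norm (by norm_num) w _)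
  rw [translate_apply, norm_mul, norm_inv, norm_pow, norm_mul, h1, div_pow, div_eq_inv_mul]
  calc (‖z‖ ^ n)⁻¹ * (Real.exp θ.im ^ n * ‖phase (-θ) x j‖ * ‖w (x - n • step j) j‖)
      ≤ (‖z‖ ^ n)⁻¹ * (Real.exp θ.im ^ n * ‖phase (-θ) x j‖ * ‖w‖) := by gcongr
    _ = _ := by ring

/-- An eigenfunction of `S` gains exactly a factor `z` per backward step, so the sequence in
`BackDecay` is constant and its limit `0` is the value of `h`. -/
theorem eq_zero_of_backDecay {z : ℂ} (hz : z ≠ 0) {h : Site → Spinor} (hd : BackDecay z h)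
    (he : shift h = z • h) : h = 0 := by
  funext x; ext j
  have hstep : ∀ y, h (y - step j) j = z * h y j := fun y => by
    rw [← shift_apply, he]
    rfl
  have hn : ∀ n : ℕ, (z ^ n)⁻¹ * h (x - n • step j) j = h x j := fun n => by
    induction n with
    | zero => simp
    | succ n ih =>
      rw [succ_nsmul, ← sub_sub, hstep, ← ih, pow_succ]
      field_simp
  have := hd x j
  simp only [hn] at this
  exact tendsto_nhds_unique tendsto_const_nhds this

theorem apply_inverse {A : Hil →L[ℂ] Hil} (hA : IsUnit A) (f : Hil) : A (Ring.inverse A f) = f :=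
  DFunLike.congr_fun (Ring.mul_inverse_cancel A hA) f

/-- Formal eigenfunctions of the walk that are small along backward rays decay exponentially. -/
theorem memℓp_translate_of_backDecay (C : Site → Matrix.unitaryGroup (Fin 4) ℂ)
    (hC : TrivialOutsideSquare C) {z θ : ℂ} (hz : Real.exp θ.im < ‖z‖) {v : Site → Spinor}
    (hv : shift (coinMul C v) = z • v) (hd : BackDecay z v) : Memℓp (translate θ v) 2 := by
  have hz0 : z ≠ 0 := norm_pos_iff.1 ((Real.exp_pos _).trans hz)
  obtain ⟨Ω, hΩ⟩ := shift_coinMul_eq C hC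
  let g : Site → Spinor := shift (coinMul C v) - shift v
  have hg : Memℓp (translate θ g) 2 := memℓp_of_finite_support Ω fun x hx =>
    translate_apply_eq_zero θ (by simp only [g, Pi.sub_apply, hΩ _ _ hx, sub_self])
  -- Chosen so that `T(-θ) w` solves `S v = z v - g`, the equation that `v` satisfies.
  let w : Hil := Ring.inverse (freeWalk θ - z • 1) (-⟨translate θ g, hg⟩)
  have hw : (freeWalk θ - z • 1) w = -⟨translate θ g, hg⟩ :=
    apply_inverse (isUnit_freeWalk_sub θ hz) _
  have hw' : translate θ (shift (translate (-θ) w)) - z • (w : Site → Spinor) =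
      -translate θ g := by
    rw [← coe_freeWalk]
    exact congrArg (fun u : Hil => (u : Site → Spinor)) hw
  have hs : shift (translate (-θ) w) = z • translate (-θ) w - g := by
    refine translate_injective θ ?_
    rw [map_sub, map_smul, translate_translate_neg, sub_eq_add_neg, ← hw']
    abel
  have hdiff : v - translate (-θ) w = 0 := by
    refine eq_zero_of_backDecay hz0 (hd.sub (backDecay_translate_neg hz w)) ?_
    rw [map_sub, hs, smul_sub, ← hv]
    simp only [g]
    abel
  rw [sub_eq_zero.1 hdiff, translate_translate_neg]
  exact lp.memℓp w

theorem hasEigenvalue_of_hasEigenvalue (C : Site → Matrix.unitaryGroup (Fin 4) ℂ)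
    (hC : TrivialOutsideSquare C) {θ₁ θ₂ z : ℂ} (h₁ : Real.exp θ₁.im < ‖z‖)
    (h₂ : Real.exp θ₂.im < ‖z‖)
    (h : Module.End.HasEigenvalue (Utheta C hC θ₁).toLinearMap z) :
    Module.End.HasEigenvalue (Utheta C hC θ₂).toLinearMap z := by
  obtain ⟨u, hu⟩ := h.exists_hasEigenvector
  have hu1 : Utheta C hC θ₁ u = z • u := hu.apply_eq_smul
  have hu2 : walkFun C θ₁ u = z • (u : Site → Spinor) :=
    congrArg (fun u : Hil => (u : Site → Spinor)) hu1
  let v : Site → Spinor := translate (-θ₁) u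
  have huv : translate θ₁ v = u := translate_translate_neg _ _
  have hv : shift (coinMul C v) = z • v := by
    refine translate_injective θ₁ ?_
    rw [← walkFun_translate, map_smul, huv, hu2]
  have hm := memℓp_translate_of_backDecay C hC h₂ hv (backDecay_translate_neg h₁ u)
  let w : Hil := ⟨translate θ₂ v, hm⟩
  refine Module.End.hasEigenvalue_of_hasEigenvector (x := w)
    (Module.End.hasEigenvector_iff.2 ⟨Module.End.mem_eigenspace_iff.2 ?_, fun h0 => hu.2 ?_⟩)
  · refine lp.ext ?_
    change walkFun C θ₂ (translate θ₂ v) = z • translate θ₂ v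
    rw [walkFun_translate, hv, map_smul]
  · have h0' : translate θ₂ v = 0 := congrArg (fun u : Hil => (u : Site → Spinor)) h0
    have hv0 : v = 0 := translate_injective θ₂ (by rw [h0', map_zero])
    refine lp.ext ?_
    rw [← huv, hv0, map_zero]
    rfl

/-- Complex translation intertwines the resolvents. -/
theorem translate_inverse_U (C : Site → Matrix.unitaryGroup (Fin 4) ℂ)
    (hC : TrivialOutsideSquare C) {z θ : ℂ} (hz : 1 < ‖z‖) (hθ : Real.exp θ.im < ‖z‖)
    (hu : IsUnit (Utheta C hC θ - z • 1)) {f : Hil} (hf : f ∈ D) :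
    translate θ (Ring.inverse (U C hC - z • 1) f) =
      Ring.inverse (Utheta C hC θ - z • 1) (T θ f hf) := by
  set u : Hil := Ring.inverse (U C hC - z • 1) f with hudef
  set w : Hil := Ring.inverse (Utheta C hC θ - z • 1) (T θ f hf) with hwdef
  have e₁ : shift (coinMul C u) - z • (u : Site → Spinor) = f :=
    congrArg (fun u : Hil => (u : Site → Spinor)) (apply_inverse (isUnit_U_sub C hC hz) f)
  have e₂ : walkFun C θ w - z • (w : Site → Spinor) = translate θ f :=
    congrArg (fun u : Hil => (u : Site → Spinor)) (apply_inverse hu (T θ f hf))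
  have e₃ : shift (coinMul C (translate (-θ) w)) - z • translate (-θ) w = f := by
    refine translate_injective θ ?_
    rw [map_sub, ← walkFun_translate, map_smul, translate_translate_neg, e₂]
  let h : Site → Spinor := u - translate (-θ) w
  have hh : shift (coinMul C h) = z • h := by
    rw [← sub_eq_zero]
    simp only [h, map_sub, smul_sub]
    rw [← sub_eq_zero.2 (e₁.trans e₃.symm)]
    abel
  -- The decay lemma is applied at parameter `0`, where it says that `h` itself lies in `ℓ²`.
  have hz0 : Real.exp (0 : ℂ).im < ‖z‖ := by simpa using hz
  have hd : BackDecay z h := by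
    refine BackDecay.sub ?_ (backDecay_translate_neg hθ w)
    simpa [translate_zero] using backDecay_translate_neg hz0 u
  have hm := memℓp_translate_of_backDecay C hC hz0 hh hd
  rw [translate_zero] at hm
  let k : Hil := ⟨h, hm⟩
  have hk : U C hC k = z • k := lp.ext hh
  -- `U` is an isometry, so `U k = z k` gives `‖k‖ = |z| ‖k‖` with `|z| > 1`.
  have hk0 : k = 0 := by
    have := norm_U_apply C hC k
    rw [hk, norm_smul] at this
    rw [← norm_eq_zero]
    nlinarith [norm_nonneg k]
  have h0 : h = 0 := congrArg (fun u : Hil => (u : Site → Spinor)) hk0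
  rw [sub_eq_zero.1 h0, translate_translate_neg]

/-! ### The pairing under complex translation, and density of `𝒟` -/

theorem conj_phase_mul (θ : ℂ) (x : Site) (j : Fin 4) :
    starRingEnd ℂ (phase (starRingEnd ℂ θ) x j) * phase θ x j = 1 := by
  fin_cases j <;> simp [phase, ← Complex.exp_conj, ← Complex.exp_add]

/-- The weights of `T(θ̄)` and `T(θ)` cancel termwise under the conjugation in the inner product, so
no boundedness of `T(θ)` is needed. -/
theorem inner_eq_inner_of_translate (θ : ℂ) {f : Hil} (hf : f ∈ D) {u w : Hil}
    (h : translate θ u = w) : inner ℂ f u = inner ℂ (T (starRingEnd ℂ θ) f hf) w := by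
  rw [lp.inner_eq_tsum, lp.inner_eq_tsum]
  refine tsum_congr fun x => ?_
  rw [← h, PiLp.inner_apply, PiLp.inner_apply]
  refine Finset.sum_congr rfl fun j _ => ?_
  have h1 : (T (starRingEnd ℂ θ) f hf : Site → Spinor) x j =
    phase (starRingEnd ℂ θ) x j * f x j := rfl
  rw [h1, translate_apply, RCLike.inner_apply, RCLike.inner_apply, map_mul]
  linear_combination (-(u x j * starRingEnd ℂ (f x j))) * conj_phase_mul θ x j

theorem mem_D_of_finite_support {f : Hil} (Ω : Finset Site) (h : ∀ x ∉ Ω, f x = 0) : f ∈ D :=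
  fun γ _ τ _ _ => memℓp_of_finite_support Ω fun x hx => by rw [h x hx, smul_zero]

/-- Finite truncations of `f` lie in `𝒟` and converge to `f`. -/
theorem dense_D : Dense D := fun f => by
  refine mem_closure_of_tendsto (lp.hasSum_single (by norm_num) f)
    (Eventually.of_forall fun s => ?_)
  refine mem_D_of_finite_support s fun x hx => ?_
  rw [lp.coeFn_sum, Finset.sum_apply]
  refine Finset.sum_eq_zero fun y hy => ?_
  exact lp.single_apply_ne _ _ _ (fun h => hx (h ▸ hy))

/-! ### Meromorphy of the translated resolvents -/

theorem isOpen_im_gt (a : ℝ) : IsOpen {κ : ℂ | a < κ.im} :=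
  isOpen_lt continuous_const Complex.continuous_im

theorem isPreconnected_im_gt (a : ℝ) : IsPreconnected {κ : ℂ | a < κ.im} :=
  (convex_halfSpace_im_gt a).isPreconnected

theorem analyticAt_sub_exp (A : Hil →L[ℂ] Hil) (κ : ℂ) :
    AnalyticAt ℂ (fun κ' => A - Complex.exp (-(Complex.I * κ')) • (1 : Hil →L[ℂ] Hil)) κ := by
  have h : AnalyticAt ℂ (fun κ' : ℂ => Complex.exp (-(Complex.I * κ'))) κ := by fun_prop
  exact analyticAt_const.sub (h.fun_smul analyticAt_const)

/-- The translated resolvents exist off a discrete set and have poles of finite rank. -/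
theorem resolvent_Utheta (C : Site → Matrix.unitaryGroup (Fin 4) ℂ) (hC : TrivialOutsideSquare C)
    {θ κ : ℂ} (hκ : θ.im < κ.im) :
    (∀ᶠ κ' in 𝓝[≠] κ, IsUnit (Utheta C hC θ - Complex.exp (-(Complex.I * κ')) • 1)) ∧
      MeromorphicFiniteRankAt (fun κ' => Rtheta C hC κ' θ) κ := by
  have hsum : ∀ κ' : ℂ, freeWalk θ - Complex.exp (-(Complex.I * κ')) • (1 : Hil →L[ℂ] Hil) +
      (Utheta C hC θ - freeWalk θ) = Utheta C hC θ - Complex.exp (-(Complex.I * κ')) • 1 :=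
    fun κ' => by abel
  have hex : ∃ κ' ∈ {κ' : ℂ | θ.im < κ'.im},
      IsUnit (freeWalk θ - Complex.exp (-(Complex.I * κ')) • (1 : Hil →L[ℂ] Hil) +
        (Utheta C hC θ - freeWalk θ)) := by
    -- At `κ' = it` one has `|e^{-iκ'}| = e^t ≥ t + 1 > ‖U(θ)‖`, so the operator is invertible
    -- there.
    let t : ℝ := max (θ.im + 1) ‖Utheta C hC θ‖
    have him : ((t : ℂ) * Complex.I).im = t := by simp
    refine ⟨t * Complex.I, ?_, ?_⟩
    · show θ.im < _
      rw [him]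
      exact (lt_add_one _).trans_le (le_max_left _ _)
    · rw [hsum]
      refine isUnit_sub_of_norm_le (norm_nonneg _) (Utheta C hC θ).le_opNorm ?_
      rw [norm_exp_neg_I_mul, him]
      linarith [Real.add_one_le_exp t, le_max_right (θ.im + 1) ‖Utheta C hC θ‖]
  have key := fredholm_finiteRank (isOpen_im_gt θ.im) (isPreconnected_im_gt θ.im)
    (fun κ' _ => analyticAt_sub_exp (freeWalk θ) κ')
    (fun κ' hκ' => isUnit_freeWalk_sub θ (by
      rw [norm_exp_neg_I_mul]
      exact Real.exp_lt_exp.2 hκ'))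
    (Utheta C hC θ - freeWalk θ) (finiteDimensional_range_Utheta_sub C hC θ) hex hκ
  simp only [hsum] at key
  exact key

theorem MeromorphicFiniteRankAt.meromorphicAt_inner {A : ℂ → Hil →L[ℂ] Hil} {κ : ℂ}
    (hA : MeromorphicFiniteRankAt A κ) (f g : Hil) :
    MeromorphicAt (fun κ' => inner ℂ f (A κ' g)) κ := by
  obtain ⟨N, B, A₀, -, hA₀, h⟩ := hA
  let ℓ : (Hil →L[ℂ] Hil) →L[ℂ] ℂ :=
    (innerSL ℂ f).comp (ContinuousLinearMap.apply ℂ Hil g)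
  have h1 : MeromorphicAt (fun κ' => ℓ (A₀ κ') +
      ∑ k : Fin N, ((κ' - κ) ^ (k.val + 1))⁻¹ * ℓ (B k)) κ := by
    refine ((ℓ.analyticAt _).comp hA₀).meromorphicAt.fun_add (MeromorphicAt.fun_sum fun k _ => ?_)
    fun_prop
  refine h1.congr ?_
  filter_upwards [h] with κ' hκ'
  have : inner ℂ f (A κ' g) = ℓ (A κ') := rfl
  rw [this, hκ', map_add, map_sum]
  simp only [map_smul, smul_eq_mul]

/-! ### Continuation of the matrix elements -/

theorem analyticAt_Ff (C : Site → Matrix.unitaryGroup (Fin 4) ℂ) (hC : TrivialOutsideSquare C)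
    (f : Hil) {κ : ℂ} (hκ : 0 < κ.im) : AnalyticAt ℂ (Ff C hC f) κ := by
  obtain ⟨u, hu⟩ := isUnit_U_sub C hC (z := Complex.exp (-(Complex.I * κ)))
    (by rw [norm_exp_neg_I_mul]; exact Real.one_lt_exp_iff.2 hκ)
  have h1 := analyticAt_inverse (𝕜 := ℂ) u
  rw [hu] at h1
  have h2 : AnalyticAt ℂ (R C hC) κ :=
    AnalyticAt.comp (g := Ring.inverse)
      (f := fun κ' => U C hC - Complex.exp (-(Complex.I * κ')) • (1 : Hil →L[ℂ] Hil)) h1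
      (analyticAt_sub_exp (U C hC) κ)
  exact (((innerSL ℂ f).comp (ContinuousLinearMap.apply ℂ Hil f)).analyticAt _).comp h2

/-- The matrix element of the translated resolvent. -/
def Ftheta (C : Site → Matrix.unitaryGroup (Fin 4) ℂ) (hC : TrivialOutsideSquare C) (θ : ℂ)
    (f : Hil) (hf : f ∈ D) (κ : ℂ) : ℂ :=
  inner ℂ (T (starRingEnd ℂ θ) f hf) (Rtheta C hC κ θ (T θ f hf))

theorem Ff_eq_Ftheta (C : Site → Matrix.unitaryGroup (Fin 4) ℂ) (hC : TrivialOutsideSquare C)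
    {θ κ : ℂ} (hκ : 0 < κ.im) (hθ : θ.im < κ.im)
    (hu : IsUnit (Utheta C hC θ - Complex.exp (-(Complex.I * κ)) • 1)) {f : Hil} (hf : f ∈ D) :
    Ff C hC f κ = Ftheta C hC θ f hf κ := by
  refine inner_eq_inner_of_translate θ hf (translate_inverse_U C hC ?_ ?_ hu hf)
  · rw [norm_exp_neg_I_mul]; exact Real.one_lt_exp_iff.2 hκ
  · rw [norm_exp_neg_I_mul]; exact Real.exp_lt_exp.2 hθ

theorem meromorphicAt_Ftheta (C : Site → Matrix.unitaryGroup (Fin 4) ℂ)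
    (hC : TrivialOutsideSquare C) {θ κ : ℂ} (hκ : θ.im < κ.im) {f : Hil} (hf : f ∈ D) :
    MeromorphicAt (Ftheta C hC θ f hf) κ :=
  (resolvent_Utheta C hC hκ).2.meromorphicAt_inner _ _

theorem exp_neg_I_mul_add_two_pi (κ : ℂ) :
    Complex.exp (-(Complex.I * (κ + 2 * Real.pi))) = Complex.exp (-(Complex.I * κ)) := by
  have h : -(Complex.I * (κ + 2 * Real.pi)) = -(Complex.I * κ) - 2 * Real.pi * Complex.I := by ring
  rw [h]
  exact Complex.exp_periodic.sub_eq _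

theorem exists_isMeromorphicExtension (C : Site → Matrix.unitaryGroup (Fin 4) ℂ)
    (hC : TrivialOutsideSquare C) {f : Hil} (hf : f ∈ D) {a : ℝ} (ha : a < 0) :
    ∃ F : ℂ → ℂ, IsMeromorphicExtension C hC f a F := by
  classical
  let θ : ℂ := a * Complex.I
  have hθ : θ.im = a := by simp [θ]
  -- An extension must equal `Ff` at every point of the upper half plane, whereas `Ff_eq_Ftheta`
  -- needs `U(θ) - e^{-iκ}` to be invertible. Gluing secures the pointwise equality; meromorphy only
  -- sees punctured neighbourhoods, where the two agree.
  refine ⟨fun κ => if 0 < κ.im then Ff C hC f κ else Ftheta C hC θ f hf κ, ⟨?_, ?_, ?_⟩⟩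
  · intro κ hκ
    have hκ' : θ.im < κ.im := by rw [hθ]; exact hκ
    refine (meromorphicAt_Ftheta C hC hκ' hf).congr ?_
    filter_upwards [(resolvent_Utheta C hC hκ').1] with κ' hu
    split_ifs with h0
    · exact (Ff_eq_Ftheta C hC h0 (by rw [hθ]; linarith) hu hf).symm
    · rfl
  · intro κ _
    have him : (κ + 2 * (Real.pi : ℂ)).im = κ.im := by simp
    simp only [him, Ff, Ftheta, R, Rtheta, exp_neg_I_mul_add_two_pi]
  · intro κ hκ
    exact if_pos hκ

theorem IsMeromorphicExtension.eventuallyEq_Ff {C : Site → Matrix.unitaryGroup (Fin 4) ℂ}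
    {hC : TrivialOutsideSquare C} {f : Hil} {a : ℝ} {F : ℂ → ℂ}
    (hF : IsMeromorphicExtension C hC f a F) {κ : ℂ} (hκ : 0 < κ.im) :
    F =ᶠ[𝓝 κ] Ff C hC f := by
  filter_upwards [(isOpen_im_gt 0).mem_nhds hκ] with κ' h using hF.extends_Ff κ' h

/-- Identity theorem: the difference has infinite order at a point of the upper half plane, hence at
every point of the connected half plane where both functions are meromorphic. -/
theorem IsMeromorphicExtension.eventuallyEq_Ftheta {C : Site → Matrix.unitaryGroup (Fin 4) ℂ}
    {hC : TrivialOutsideSquare C} {f : Hil} (hf : f ∈ D) {a : ℝ} {F : ℂ → ℂ}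
    (hF : IsMeromorphicExtension C hC f a F) {θ κ : ℂ} (hκ : a < κ.im) (hθ : θ.im < κ.im) :
    F =ᶠ[𝓝[≠] κ] Ftheta C hC θ f hf := by
  let b : ℝ := max a θ.im
  have hmer : MeromorphicOn (F - Ftheta C hC θ f hf) {κ' | b < κ'.im} := fun κ' hκ' =>
    by
    have h1 : a < κ'.im := (le_max_left _ _).trans_lt hκ'
    have h2 : θ.im < κ'.im := (le_max_right _ _).trans_lt hκ'
    exact (hF.meromorphic κ' h1).sub (meromorphicAt_Ftheta C hC h2 hf)
  -- The point `it` lies in the common half plane `Im > b` and also in `Im > 0`, where `F` is known.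
  let t : ℝ := max b 0 + 1
  have him : ((t : ℂ) * Complex.I).im = t := by simp
  have ht0 : 0 < ((t : ℂ) * Complex.I).im := by
    rw [him]; exact lt_of_le_of_lt (le_max_right b 0) (lt_add_one _)
  have htb : b < ((t : ℂ) * Complex.I).im := by
    rw [him]; exact lt_of_le_of_lt (le_max_left b 0) (lt_add_one _)
  have htθ : θ.im < ((t : ℂ) * Complex.I).im := (le_max_right _ _).trans_lt htb
  have htop : meromorphicOrderAt (F - Ftheta C hC θ f hf) (t * Complex.I) = ⊤ := by
    rw [meromorphicOrderAt_eq_top_iff]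
    filter_upwards [eventually_nhdsWithin_of_eventually_nhds (hF.eventuallyEq_Ff ht0),
      eventually_nhdsWithin_of_eventually_nhds ((isOpen_im_gt 0).mem_nhds ht0),
      eventually_nhdsWithin_of_eventually_nhds ((isOpen_im_gt θ.im).mem_nhds htθ),
      (resolvent_Utheta C hC htθ).1] with κ' h1 h2 h3 h4
    rw [Pi.sub_apply, h1, Ff_eq_Ftheta C hC h2 h3 h4 hf, sub_self]
  have hκtop : meromorphicOrderAt (F - Ftheta C hC θ f hf) κ = ⊤ := by
    by_contra hne
    exact hmer.meromorphicOrderAt_ne_top_of_isPreconnected (isPreconnected_im_gt b)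
      (max_lt hκ hθ) htb hne htop
  filter_upwards [meromorphicOrderAt_eq_top_iff.1 hκtop] with κ' h
  exact sub_eq_zero.1 h

end QW

end

theorem mainTheorem6 (C : QW.Site → Matrix.unitaryGroup (Fin 4) ℂ)
    (hC : QW.TrivialOutsideSquare C) :
    -- the class `𝒟` is dense
    Dense QW.D ∧
    -- `R(κ)` exists for `Im κ > 0`
    (∀ κ : ℂ, 0 < κ.im → IsUnit (QW.U C hC - Complex.exp (-(Complex.I * κ)) • 1)) ∧
    -- for every `f ∈ 𝒟` and `a < 0`
    (∀ (f : QW.Hil) (hf : f ∈ QW.D) (a : ℝ), a < 0 →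
      -- `F_f` has a meromorphic extension to `Im κ > a`, and for this extension
      (∃ F : ℂ → ℂ, QW.IsMeromorphicExtension C hC f a F) ∧
      ∀ F : ℂ → ℂ, QW.IsMeromorphicExtension C hC f a F →
        -- poles are real or in the lower half plane
        (∀ κ : ℂ, a < κ.im → meromorphicOrderAt F κ < 0 → κ.im = 0 ∨ κ.im < 0) ∧
        -- it is given by the resolvents `R(κ, θ)`
        (∀ θ : ℂ, θ.im < 0 → ∀ κ : ℂ, a < κ.im → θ.im < κ.im →
          ∀ᶠ κ' in 𝓝[≠] κ, F κ' =
            inner ℂ (QW.T (starRingEnd ℂ θ) f hf) (QW.Rtheta C hC κ' θ (QW.T θ f hf)))) ∧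
    -- which exist off a discrete set and are meromorphic, with poles of finite rank
    (∀ θ : ℂ, θ.im < 0 → ∀ κ : ℂ, θ.im < κ.im →
      (∀ᶠ κ' in 𝓝[≠] κ,
        IsUnit (QW.Utheta C hC θ - Complex.exp (-(Complex.I * κ')) • 1)) ∧
      QW.MeromorphicFiniteRankAt (fun κ' => QW.Rtheta C hC κ' θ) κ) ∧
    -- eigenvalues of `U(θ)` in `|z| > e^{Im θ}` do not depend on `θ`
    (∀ θ₁ θ₂ : ℂ, θ₁.im ≤ 0 → θ₂.im ≤ 0 → ∀ z : ℂ,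
      Real.exp θ₁.im < ‖z‖ → Real.exp θ₂.im < ‖z‖ →
      (Module.End.HasEigenvalue (QW.Utheta C hC θ₁).toLinearMap z ↔
        Module.End.HasEigenvalue (QW.Utheta C hC θ₂).toLinearMap z)) := by
  refine ⟨QW.dense_D, fun κ hκ => QW.isUnit_U_sub C hC ?_, fun f hf a ha =>
    ⟨QW.exists_isMeromorphicExtension C hC hf ha, fun F hF => ⟨fun κ _ hord => ?_,
      fun θ _ κ hκ hθκ => hF.eventuallyEq_Ftheta hf hκ hθκ⟩⟩,
    fun θ _ κ hκ => QW.resolvent_Utheta C hC hκ,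
    fun θ₁ θ₂ _ _ z h₁ h₂ => ⟨QW.hasEigenvalue_of_hasEigenvalue C hC h₁ h₂,
      QW.hasEigenvalue_of_hasEigenvalue C hC h₂ h₁⟩⟩
  · rw [QW.norm_exp_neg_I_mul]
    exact Real.one_lt_exp_iff.2 hκ
  · by_contra! hcon
    have hpos : 0 < κ.im := lt_of_le_of_ne hcon.2 hcon.1.symm
    -- In the upper half plane `F` coincides with the holomorphic function `Ff`, so its order there
    -- cannot be negative.
    have hana := (QW.analyticAt_Ff C hC f hpos).congr (hF.eventuallyEq_Ff hpos).symm
    exact absurd hana.meromorphicOrderAt_nonneg (not_le.2 hord)
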